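/- Let $Z=(Z_1,\dots,Z_d)$ be an $\mathbb{R}^d$-valued L\'evy process and martingale, with characteristic triplet $(a,Q,\nu)$ (that is, $\mathbb{E}\,e^{i\langle u,Z(t)\rangle}=e^{t\psi(u)}$ with $\psi(u)=i\langle a,u\rangle-\frac12\langle Qu,u\rangle+\int_{\mathbb{R}^d}\big(e^{i\langle u,y\rangle}-1-i\langle u,y\rangle\mathbf 1_{\{|y|\le 1\}}\big)\nu(dy)$), and let $G=(G_1,\dots,G_d):[0,+\infty)\to\mathbb{R}^d$. For $x\ge 0$ let $\nu_{G(x)}$ be the image of the L\'evy measure $\nu$ under $y\mapsto\langle G(x),y\rangle$. The pair $(G,Z)$ is called a generating pair if (i) for each $x\ge 0$ the measure $\nu_{G(x)}$ is supported in $[0,+\infty)$, i.e. $\langle G(x),Z\rangle$ has positive jumps only; (ii) $\int_{(0,+\infty)}v\,\nu_{G(0)}(dv)<+\infty$; (iii) there are a constant $c\ge 0$ and a measure $\mu$ on $(0,+\infty)$ with $\int_{(0,+\infty)}(v\wedge v^2)\,\mu(dv)<+\infty$ such that, for all $x\ge 0$, $$\tfrac12\langle QG(x),G(x)\rangle=cx,\qquad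 \nu_{G(x)}|_{(0,+\infty)}=\nu_{G(0)}|_{(0,+\infty)}+x\,\mu .$$ Suppose that $(G,Z)$ is a generating pair, that the coordinates $Z_1,\dots,Z_d$ are independent, and that each $Z_i$ is of infinite variation, i.e. it is not the case that almost all paths of $Z_i$ have finite variation on every compact time interval (for a L\'evy process this is equivalent to almost all paths having infinite variation on $[0,t]$ for every $t>0$). Then $G(0)=0$. -/

import Mathlib

open MeasureTheory ProbabilityTheory
open scoped NNReal ENNReal

namespace LevyAffine

noncomputable section

/-- A Lévy process in `ℝᵈ` on the probability space `(Ω, P)`: it starts at `0`, has independent and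
stationary increments, and almost all of its paths are right-continuous with left limits. -/
structure IsLevyProcess {Ω : Type*} [MeasurableSpace Ω] {d : ℕ}
    (Z : ℝ≥0 → Ω → EuclideanSpace ℝ (Fin d)) (P : Measure Ω) : Prop where
  measurable : ∀ t, AEMeasurable (Z t) P
  start_zero : ∀ᵐ ω ∂P, Z 0 ω = 0
  indep_increments : HasIndepIncrements Z P
  stationary_increments : ∀ s h : ℝ≥0, IdentDistrib (Z (s + h) - Z s) (Z h) P P
  cadlag : ∀ᵐ ω ∂P, ∀ t : ℝ≥0,
    ContinuousWithinAt (fun s => Z s ω) (Set.Ici t) t ∧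
      ∃ l, Filter.Tendsto (fun s => Z s ω) (nhdsWithin t (Set.Iio t)) (nhds l)

/-- A Lévy process that is a martingale (with respect to some filtration, equivalently with
respect to its natural one). -/
structure IsLevyMartingale {Ω : Type*} [mΩ : MeasurableSpace Ω] {d : ℕ}
    (Z : ℝ≥0 → Ω → EuclideanSpace ℝ (Fin d)) (P : Measure Ω) : Prop where
  levy : IsLevyProcess Z P
  martingale : ∃ ℱ : Filtration ℝ≥0 mΩ, Martingale Z ℱ P

/-- The quadratic form `⟨Q u, u⟩` of a matrix. -/
def quadForm {d : ℕ} (Q : Matrix (Fin d) (Fin d) ℝ) (u : EuclideanSpace ℝ (Fin d)) : ℝ :=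
  ∑ i, ∑ j, Q i j * u j * u i

/-- A Lévy measure on `ℝᵈ`: a Borel measure without mass at `0` for which
`∫ (|y|² ∧ 1) ν(dy) < ∞`. -/
structure IsLevyMeasure {d : ℕ} (ν : Measure (EuclideanSpace ℝ (Fin d))) : Prop where
  zero : ν {0} = 0
  integrable : ∫⁻ y, ENNReal.ofReal (min (‖y‖ ^ 2) 1) ∂ν < ∞

open Classical in
/-- The characteristic exponent of the triplet `(a, Q, ν)`, in the Lévy-Khintchine form with
truncation to the closed unit ball:
`ψ(u) = i⟨a,u⟩ - ½⟨Qu,u⟩ + ∫ (e^{i⟨u,y⟩} - 1 - i⟨u,y⟩ 1_{|y| ≤ 1}) ν(dy)`. -/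
def levyExponent {d : ℕ} (a : EuclideanSpace ℝ (Fin d)) (Q : Matrix (Fin d) (Fin d) ℝ)
    (ν : Measure (EuclideanSpace ℝ (Fin d))) (u : EuclideanSpace ℝ (Fin d)) : ℂ :=
  Complex.I * (inner ℝ a u : ℝ) - (quadForm Q u : ℝ) / 2 +
    ∫ y, (Complex.exp (Complex.I * (inner ℝ u y : ℝ)) - 1 -
      if ‖y‖ ≤ 1 then Complex.I * (inner ℝ u y : ℝ) else 0) ∂ν

/-- `(a, Q, ν)` is the characteristic triplet of the process `Z`:
`𝔼 e^{i⟨u, Z(t)⟩} = e^{t ψ(u)}` for all `t` and `u`. -/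
structure HasTriplet {Ω : Type*} [MeasurableSpace Ω] {d : ℕ}
    (Z : ℝ≥0 → Ω → EuclideanSpace ℝ (Fin d)) (P : Measure Ω)
    (a : EuclideanSpace ℝ (Fin d)) (Q : Matrix (Fin d) (Fin d) ℝ)
    (ν : Measure (EuclideanSpace ℝ (Fin d))) : Prop where
  posSemidef : Q.PosSemidef
  levyMeasure : IsLevyMeasure ν
  charFun_eq : ∀ (t : ℝ≥0) (u : EuclideanSpace ℝ (Fin d)),
    charFun (P.map (Z t)) u = Complex.exp ((t : ℝ) * levyExponent a Q ν u)

/-- The image `ν_g` of `ν` under the projection `y ↦ ⟨g, y⟩`. -/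
def projMeasure {d : ℕ} (ν : Measure (EuclideanSpace ℝ (Fin d)))
    (g : EuclideanSpace ℝ (Fin d)) : Measure ℝ :=
  ν.map (fun y => inner ℝ g y)

/-- The conditions which make `(G, Z)` a generating pair, in terms of the Gaussian covariance
matrix `Q` and the Lévy measure `ν` of `Z`. -/
structure GeneratingConditions {d : ℕ} (G : ℝ≥0 → EuclideanSpace ℝ (Fin d))
    (Q : Matrix (Fin d) (Fin d) ℝ) (ν : Measure (EuclideanSpace ℝ (Fin d))) : Prop where
  /-- The projections `⟨G(x), Z⟩` have positive jumps only. -/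
  positive_jumps : ∀ x, projMeasure ν (G x) (Set.Iio 0) = 0
  /-- The jump part of `⟨G(0), Z⟩` has finite variation. -/
  finite_variation_zero : ∫⁻ v in Set.Ioi 0, ENNReal.ofReal v ∂(projMeasure ν (G 0)) < ∞
  /-- The triplet of `⟨G(x), Z⟩` is affine in `x`. -/
  affine : ∃ (c : ℝ) (μ : Measure ℝ), 0 ≤ c ∧ μ (Set.Iic 0) = 0 ∧
    (∫⁻ v in Set.Ioi 0, ENNReal.ofReal (min v (v ^ 2)) ∂μ < ∞) ∧
    ∀ x : ℝ≥0, quadForm Q (G x) / 2 = c * x ∧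
      (projMeasure ν (G x)).restrict (Set.Ioi 0) =
        (projMeasure ν (G 0)).restrict (Set.Ioi 0) + (x : ℝ≥0∞) • μ

/-- `(G, Z)` is a generating pair: `Z` is a Lévy martingale and its projections `⟨G(x), Z⟩` satisfy
the generating conditions. -/
def IsGeneratingPair {Ω : Type*} [MeasurableSpace Ω] {d : ℕ}
    (G : ℝ≥0 → EuclideanSpace ℝ (Fin d)) (Z : ℝ≥0 → Ω → EuclideanSpace ℝ (Fin d))
    (P : Measure Ω) : Prop :=
  IsLevyMartingale Z P ∧
    ∃ a Q ν, HasTriplet Z P a Q ν ∧ GeneratingConditions G Q ν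

/-- The coordinates of `Z` are independent, as processes. -/
def HasIndepCoordinates {Ω : Type*} [MeasurableSpace Ω] {d : ℕ}
    (Z : ℝ≥0 → Ω → EuclideanSpace ℝ (Fin d)) (P : Measure Ω) : Prop :=
  iIndepFun (fun (i : Fin d) (ω : Ω) (t : ℝ≥0) => Z t ω i) P

/-- A real process is of finite variation if almost all of its paths have finite variation on every
compact time interval. -/
def IsFiniteVariation {Ω : Type*} [MeasurableSpace Ω] (X : ℝ≥0 → Ω → ℝ) (P : Measure Ω) : Prop :=
  ∀ᵐ ω ∂P, LocallyBoundedVariationOn (fun t => X t ω) Set.univ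

/-- A real process is of infinite variation if it is not of finite variation. For a Lévy process
this is equivalent to almost all paths having infinite variation on every interval `[0, t]`,
`t > 0`. -/
def IsInfiniteVariation {Ω : Type*} [MeasurableSpace Ω] (X : ℝ≥0 → Ω → ℝ) (P : Measure Ω) : Prop :=
  ¬ IsFiniteVariation X P

end

end LevyAffine

namespace LevyAffine

open Filter Topology Set

/-! Write `g = G 0`. At `x = 0` the affine condition leaves `⟨g, Z⟩` without Gaussian part, and its
jumps are nonnegative with finite first moment. Hence `⟨g, Z⟩` is a drift plus a sum of nonnegative
jumps, and `⟨g, Z 1⟩` is bounded below (`exists_ae_le_inner`). This is read off the characteristic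
function: the law without drift is a weak limit of laws on `[0, ∞)`.

A sum of independent variables is bounded below only if each summand is, so every `g i * Z 1 i` is
bounded below. A Lévy process bounded below at time 1 is increasing up to a linear drift, since
otherwise many independent short increments would all be too low with positive probability
(`isFiniteVariation_of_ae_le`). So `g i ≠ 0` would force `Z_i` to have finite variation. -/

/-! ### Laws carried by the half-line -/

/-- Lévy's continuity theorem gives weak convergence; the portmanteau inequality for the open set
`Iio 0` does the rest. -/
lemma ae_nonneg_of_tendsto_charFun {μ : ℕ → Measure ℝ} [∀ n, IsProbabilityMeasure (μ n)]
    {ρ : Measure ℝ} [IsProbabilityMeasure ρ] (hμ : ∀ n, μ n (Iio 0) = 0)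
    (h : ∀ t, Tendsto (fun n => charFun (μ n) t) atTop (𝓝 (charFun ρ t))) : ρ (Iio 0) = 0 := by
  have h1 : Tendsto (β := ProbabilityMeasure ℝ) (fun n => ⟨μ n, inferInstance⟩) atTop
      (𝓝 ⟨ρ, inferInstance⟩) := ProbabilityMeasure.tendsto_of_tendsto_charFun h
  have h2 := ProbabilityMeasure.le_liminf_measure_open_of_tendsto h1 (isOpen_Iio (a := (0 : ℝ)))
  simpa [hμ] using h2

/-- Take the law of a sum of `n` independent nonnegative variables, that is, the convolution power.
-/
lemma exists_nonneg_charFun_eq_pow {ρ : Measure ℝ} [IsProbabilityMeasure ρ] (hρ : ρ (Iio 0) = 0)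
    (n : ℕ) : ∃ σ : Measure ℝ, IsProbabilityMeasure σ ∧ σ (Iio 0) = 0 ∧
      ∀ t, charFun σ t = charFun ρ t ^ n := by
  induction n with
  | zero => exact ⟨Measure.dirac 0, inferInstance, by simp, fun t => by simp [charFun_dirac]⟩
  | succ n ih =>
    obtain ⟨σ, hσ, hσ0, hc⟩ := ih
    refine ⟨σ ∗ ρ, inferInstance, ?_, fun t => by rw [charFun_conv, hc, pow_succ]⟩
    rw [Measure.conv, Measure.map_apply (by fun_prop) measurableSet_Iio]
    have h1 : ∀ᵐ p ∂(σ.prod ρ), p.1 ∉ Iio (0 : ℝ) :=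
      Measure.quasiMeasurePreserving_fst.ae (measure_eq_zero_iff_ae_notMem.1 hσ0)
    have h2 : ∀ᵐ p ∂(σ.prod ρ), p.2 ∉ Iio (0 : ℝ) :=
      Measure.quasiMeasurePreserving_snd.ae (measure_eq_zero_iff_ae_notMem.1 hρ)
    rw [measure_eq_zero_iff_ae_notMem]
    filter_upwards [h1, h2] with p hp hq
    simp only [mem_Iio, not_lt, mem_preimage] at *
    linarith

lemma norm_cexp_I_mul_sub_one_le (x : ℝ) : ‖Complex.exp (Complex.I * x) - 1‖ ≤ |x| := by
  simpa using Real.norm_exp_I_mul_ofReal_sub_one_le (x := x)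

lemma integrable_cexp_sub_one {α : Type*} [MeasurableSpace α] {ν : Measure α} {f : α → ℝ}
    (hf : Integrable f ν) (s : ℝ) :
    Integrable (fun y => Complex.exp (Complex.I * (s * f y : ℝ)) - 1) ν := by
  refine (hf.const_mul s).mono ?_ (ae_of_all _ fun y => ?_)
  · have := hf.aestronglyMeasurable
    have h : Continuous fun x : ℝ => Complex.exp (Complex.I * (s * x : ℝ)) - 1 := by fun_prop
    exact h.comp_aestronglyMeasurable this
  · simpa using norm_cexp_I_mul_sub_one_le (s * f y)

/-- A law with characteristic function `exp (∫ (e^{isv} - 1) ν(dv))`, where the jump measure `ν` is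
carried by nonnegative jumps and has a finite first moment, is carried by `[0, ∞)`. -/
lemma measure_Iio_eq_zero_of_charFun_eq {α : Type*} [MeasurableSpace α] {ν : Measure α} {f : α → ℝ}
    (hfm : Measurable f) (hf : Integrable f ν) (hf0 : 0 ≤ᵐ[ν] f)
    {ρ : Measure ℝ} [IsProbabilityMeasure ρ]
    (h : ∀ s : ℝ, charFun ρ s =
      Complex.exp (∫ y, (Complex.exp (Complex.I * (s * f y : ℝ)) - 1) ∂ν)) :
    ρ (Iio 0) = 0 := by
  -- With the threshold `K / (n + 1)`, Markov's inequality gives `ν (A n) ≤ n + 1`; the added 1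
  -- makes `K` positive.
  set K : ℝ := (∫ y, f y ∂ν) + 1 with hK
  have hI0 : 0 ≤ ∫ y, f y ∂ν := integral_nonneg_of_ae hf0
  have hK0 : 0 < K := by linarith
  let A : ℕ → Set α := fun n => {y | K / (n + 1) ≤ f y}
  have hA (n : ℕ) : MeasurableSet (A n) := measurableSet_le measurable_const hfm
  have hpos (n : ℕ) : (0 : ℝ) < n + 1 := by positivity
  have hfin (n : ℕ) : ν (A n) ≠ ∞ := (hf.measure_ge_lt_top (by positivity)).ne
  have hmass (n : ℕ) : ν.real (A n) ≤ n + 1 := by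
    have := mul_meas_ge_le_integral_of_nonneg hf0 hf (K / (n + 1))
    have h3 : K / (n + 1) * ν.real (A n) ≤ K := this.trans (by linarith)
    rw [div_mul_eq_mul_div, div_le_iff₀ (hpos n)] at h3
    exact le_of_mul_le_mul_left h3 hK0
  let c : ℕ → ℝ≥0 := fun n => ⟨1 / (n + 1), by positivity⟩
  let c' : ℕ → ℝ≥0 := fun n => ⟨1 - ν.real (A n) / (n + 1),
    sub_nonneg.2 ((div_le_one (hpos n)).2 (hmass n))⟩
  -- One of `n + 1` independent trials: a jump from `A n` at rate `1 / (n + 1)`, otherwise 0. Their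
  -- sum approximates the compound Poisson law by `(1 + z / n) ^ n → exp z`.
  let τ : ℕ → Measure ℝ := fun n => c n • (ν.restrict (A n)).map f + c' n • Measure.dirac 0
  have hfr (n : ℕ) : IsFiniteMeasure (ν.restrict (A n)) :=
    ⟨by simpa using (hfin n).lt_top⟩
  have hτfin (n : ℕ) : IsFiniteMeasure (τ n) := by dsimp only [τ]; infer_instance
  have hτc (n : ℕ) (s : ℝ) : charFun (τ n) s =
      1 + (∫ y in A n, (Complex.exp (Complex.I * (s * f y : ℝ)) - 1) ∂ν) / (n + 1) := by
    have hbd (κ : Measure ℝ) [IsFiniteMeasure κ] :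
        Integrable (fun x : ℝ => Complex.exp (s * x * Complex.I)) κ := by
      refine Integrable.of_bound (by fun_prop) 1 (ae_of_all _ fun x => ?_)
      rw [← Complex.ofReal_mul, Complex.norm_exp_ofReal_mul_I]
    have hbd' : Integrable (fun y => Complex.exp (Complex.I * (s * f y : ℝ))) (ν.restrict (A n)) := by
      refine Integrable.of_bound (by fun_prop) 1 (ae_of_all _ fun x => ?_)
      rw [mul_comm, Complex.norm_exp_ofReal_mul_I]
    rw [charFun_apply_real, integral_add_measure (hbd _) (hbd _), integral_smul_nnreal_measure,
      integral_smul_nnreal_measure, integral_dirac, integral_map (by fun_prop) (by fun_prop),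
      integral_sub hbd' (integrable_const _)]
    have hsm (r : ℝ≥0) (z : ℂ) : r • z = (r : ℝ) * z := by
      rw [NNReal.smul_def, Complex.real_smul]
    have hc : ((c n : ℝ≥0) : ℝ) = 1 / (n + 1) := rfl
    have hc' : ((c' n : ℝ≥0) : ℝ) = 1 - ν.real (A n) / (n + 1) := rfl
    simp only [integral_const, hsm, hc, hc', measureReal_restrict_apply_univ]
    have : ((n : ℂ) + 1) ≠ 0 := by exact_mod_cast (hpos n).ne'
    have e : ∫ y in A n, Complex.exp (s * f y * Complex.I) ∂ν =
        ∫ y in A n, Complex.exp (Complex.I * (s * f y : ℝ)) ∂ν := by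
      congr 1; ext y; push_cast; ring_nf
    rw [e, Complex.real_smul]
    simp only [Complex.ofReal_div, Complex.ofReal_add, Complex.ofReal_sub, Complex.ofReal_one,
      Complex.ofReal_natCast, Complex.ofReal_zero, mul_zero, zero_mul, Complex.exp_zero, mul_one]
    field_simp
    ring
  have hτp (n : ℕ) : IsProbabilityMeasure (τ n) := by
    have := hτc n 0
    rw [charFun_zero] at this
    simp at this
    exact ⟨by simpa [measureReal_def, ENNReal.toReal_eq_one_iff] using this⟩
  have hτ0 (n : ℕ) : τ n (Iio 0) = 0 := by
    have h0 : (ν.restrict (A n)).map f (Iio 0) = 0 := by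
      rw [Measure.map_apply hfm measurableSet_Iio, measure_eq_zero_iff_ae_notMem]
      filter_upwards [ae_restrict_of_ae hf0] with y hy
      simpa using hy
    simp [τ, h0]
  choose σ hσp hσ0 hσc using fun n => exists_nonneg_charFun_eq_pow (hτ0 n) (n + 1)
  refine ae_nonneg_of_tendsto_charFun (μ := σ) hσ0 fun s => ?_
  simp only [hσc, hτc, h]
  set F : α → ℂ := fun y => Complex.exp (Complex.I * (s * f y : ℝ)) - 1 with hF
  have hFi : Integrable F ν := integrable_cexp_sub_one hf s
  have hlim : Tendsto (fun n => ∫ y in A n, F y ∂ν) atTop (𝓝 (∫ y, F y ∂ν)) := by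
    simp_rw [← integral_indicator (hA _)]
    refine tendsto_integral_of_dominated_convergence (fun y => ‖F y‖)
      (fun n => hFi.aestronglyMeasurable.indicator (hA n)) hFi.norm
      (fun n => ae_of_all _ fun y => norm_indicator_le_norm_self _ _) ?_
    -- The integrand vanishes where `f y = 0`; any `y` with `f y > 0` eventually lies in `A n`.
    filter_upwards [hf0] with y hy
    rcases (show 0 ≤ f y from hy).eq_or_lt with h0 | h0
    · have : F y = 0 := by simp [hF, ← h0]
      simp [indicator, this]
    · refine tendsto_const_nhds.congr' ?_
      have h4 : Tendsto (fun n : ℕ => K / ((n : ℝ) + 1)) atTop (𝓝 0) :=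
        tendsto_const_nhds.div_atTop
          (tendsto_atTop_add_const_right _ _ tendsto_natCast_atTop_atTop)
      filter_upwards [h4.eventually (ge_mem_nhds h0)] with n hn
      rw [indicator_of_mem (show y ∈ A n from hn)]
  -- The index is shifted because the exponential limit is stated for the power `n`, while `τ n` is
  -- raised to `n + 1`.
  have h5 : Tendsto (fun n : ℕ => (n : ℂ) * ((∫ y in A (n - 1), F y ∂ν) / n)) atTop
      (𝓝 (∫ y, F y ∂ν)) := by
    refine (tendsto_add_atTop_iff_nat 1).1 (hlim.congr fun n => ?_)
    have : ((n : ℂ) + 1) ≠ 0 := by exact_mod_cast (hpos n).ne'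
    push_cast
    rw [mul_div_cancel₀ _ this]
  have h6 := (tendsto_add_atTop_iff_nat 1).2 (Complex.tendsto_one_add_pow_exp_of_tendsto h5)
  simpa using h6

/-! ### Lower bounds and path variation -/

/-- If the sum of two independent variables is bounded below, then so is each of them. -/
lemma exists_ae_le_of_indepFun {Ω : Type*} [MeasurableSpace Ω] {P : Measure Ω}
    [IsProbabilityMeasure P] {A B : Ω → ℝ} (hAB : IndepFun A B P) {b : ℝ}
    (h : ∀ᵐ ω ∂P, b ≤ A ω + B ω) : ∃ C : ℝ, ∀ᵐ ω ∂P, -C ≤ A ω := by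
  -- The events `A < b - M` and `B < M` are almost surely incompatible, so by independence one of
  -- them is null.
  obtain ⟨M, hM⟩ : ∃ M : ℕ, P (B ⁻¹' Iio (M : ℝ)) ≠ 0 := by
    by_contra! hcon
    have h1 : P (⋃ M : ℕ, B ⁻¹' Iio (M : ℝ)) = 0 := measure_iUnion_null hcon
    have h2 : (⋃ M : ℕ, B ⁻¹' Iio (M : ℝ)) = univ := by
      ext ω
      simpa using exists_nat_gt (B ω)
    simp [h2] at h1
  have h1 := hAB.measure_inter_preimage_eq_mul (Iio (b - M)) (Iio (M : ℝ))
    measurableSet_Iio measurableSet_Iio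
  have h2 : P (A ⁻¹' Iio (b - M) ∩ B ⁻¹' Iio (M : ℝ)) = 0 := by
    rw [measure_eq_zero_iff_ae_notMem]
    filter_upwards [h] with ω hω
    simp only [mem_inter_iff, mem_preimage, mem_Iio, not_and, not_lt]
    intro h3
    linarith
  rw [h2, eq_comm, mul_eq_zero, or_iff_left hM, measure_eq_zero_iff_ae_notMem] at h1
  refine ⟨M - b, ?_⟩
  filter_upwards [h1] with ω hω
  simp only [mem_preimage, mem_Iio, not_lt] at hω
  linarith

lemma locallyBoundedVariationOn_sub {α E : Type*} [LinearOrder α] [SeminormedAddCommGroup E]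
    {f g : α → E} {s : Set α} (hf : LocallyBoundedVariationOn f s)
    (hg : LocallyBoundedVariationOn g s) : LocallyBoundedVariationOn (f - g) s := by
  intro a b ha hb
  refine ne_top_of_le_ne_top (ENNReal.add_ne_top.2 ⟨hf a b ha hb, hg a b ha hb⟩) (iSup_le fun p => ?_)
  refine le_trans ?_ (add_le_add (eVariationOn.sum_le (n := p.1) p.2.2.1 p.2.2.2)
    (eVariationOn.sum_le (n := p.1) p.2.2.1 p.2.2.2))
  rw [← Finset.sum_add_distrib]
  gcongr with i hi
  simp only [edist_eq_enorm_sub, Pi.sub_apply]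
  rw [sub_sub_sub_comm]
  exact enorm_sub_le

/-- A right-continuous function with `f t - f s ≥ -C (t - s)` for rational `s ≤ t` is locally of
bounded variation. -/
lemma locallyBoundedVariationOn_of_forall_nat_div {f : ℝ≥0 → ℝ} {C : ℝ}
    (hf : ∀ t, ContinuousWithinAt f (Ici t) t)
    (h : ∀ k l n : ℕ, -C * (l / (n + 1) : ℝ≥0) ≤
      f (k / (n + 1) + l / (n + 1) : ℝ≥0) - f (k / (n + 1) : ℝ≥0)) :
    LocallyBoundedVariationOn f univ := by
  set g : ℝ≥0 → ℝ := fun t => f t + C * t with hg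
  have hgc (t : ℝ≥0) : ContinuousWithinAt g (Ici t) t := (hf t).add (by fun_prop)
  -- The `+ 1` puts the grid points to the right of `t`, where continuity is available. The mesh
  -- does not depend on `t`, so two such points differ by a grid length.
  have happ (t : ℝ≥0) : Tendsto (fun n : ℕ => ((⌊t * (n + 1)⌋₊ + 1 : ℕ) : ℝ≥0) / (n + 1)) atTop
      (𝓝[≥] t) := by
    refine tendsto_nhdsWithin_iff.2 ⟨?_, Eventually.of_forall fun n => ?_⟩
    · have h1 : Tendsto (fun n : ℕ => t + 1 / ((n : ℝ≥0) + 1)) atTop (𝓝 t) := by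
        simpa using tendsto_const_nhds.add (tendsto_one_div_add_atTop_nhds_zero_nat (𝕜 := ℝ≥0))
      refine tendsto_of_tendsto_of_tendsto_of_le_of_le tendsto_const_nhds h1 (fun n => ?_)
        (fun n => ?_)
      · dsimp only
        rw [le_div_iff₀ (by positivity)]
        push_cast
        exact (Nat.lt_floor_add_one _).le
      · dsimp only
        rw [div_le_iff₀ (by positivity), add_mul, one_div, inv_mul_cancel₀ (by positivity)]
        push_cast
        gcongr
        exact Nat.floor_le (by positivity)
    · rw [mem_Ici, le_div_iff₀ (by positivity)]
      push_cast
      exact (Nat.lt_floor_add_one _).le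
  have hmono : Monotone g := by
    intro s t hst
    refine le_of_tendsto_of_tendsto' ((hgc s).tendsto.comp (happ s)) ((hgc t).tendsto.comp (happ t))
      fun n => ?_
    have hle : ⌊s * (n + 1)⌋₊ ≤ ⌊t * (n + 1)⌋₊ := Nat.floor_mono (by gcongr)
    obtain ⟨l, hl⟩ := Nat.exists_eq_add_of_le hle
    have h2 := h (⌊s * (n + 1)⌋₊ + 1) l n
    have e : ((⌊t * (n + 1)⌋₊ + 1 : ℕ) : ℝ≥0) / (n + 1) =
        ((⌊s * (n + 1)⌋₊ + 1 : ℕ) : ℝ≥0) / (n + 1) + l / (n + 1) := by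
      rw [hl]; push_cast; ring
    simp only [Function.comp, hg]
    rw [e]
    push_cast at h2 ⊢
    linarith
  have h3 : f = g - fun t : ℝ≥0 => C * t := by ext t; simp [hg]
  rw [h3]
  refine locallyBoundedVariationOn_sub (hmono.monotoneOn _).locallyBoundedVariationOn ?_
  have h4 : Monotone fun t : ℝ≥0 => (t : ℝ) := NNReal.coe_mono
  exact (lipschitzWith_smul C).comp_locallyBoundedVariationOn
    (h4.monotoneOn univ).locallyBoundedVariationOn

/-- A real process with stationary and independent increments whose value at time `1` is bounded
below is, up to a drift, increasing. -/
lemma isFiniteVariation_of_ae_le {Ω : Type*} [MeasurableSpace Ω] {P : Measure Ω}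
    [IsProbabilityMeasure P] {X : ℝ≥0 → Ω → ℝ} (hX0 : ∀ᵐ ω ∂P, X 0 ω = 0)
    (hind : HasIndepIncrements X P)
    (hstat : ∀ s h : ℝ≥0, IdentDistrib (X (s + h) - X s) (X h) P P)
    (hcont : ∀ᵐ ω ∂P, ∀ t, ContinuousWithinAt (fun s => X s ω) (Ici t) t)
    {C : ℝ} (hC : ∀ᵐ ω ∂P, -C ≤ X 1 ω) : IsFiniteVariation X P := by
  have hinc {s h : ℝ≥0} {c : ℝ} (hc : ∀ᵐ ω ∂P, c ≤ X h ω) :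
      ∀ᵐ ω ∂P, c ≤ X (s + h) ω - X s ω :=
    (hstat s h).symm.ae_snd measurableSet_Ici hc
  -- Independent increments can all fall below `c` at once with positive probability. The count
  -- starts at one because an empty sum is not `< 0`.
  have hpow (h : ℝ≥0) (c : ℝ) (hc : P (X h ⁻¹' Iio c) ≠ 0) (k : ℕ) :
      P (X ((k + 1) * h) ⁻¹' Iio ((k + 1) * c)) ≠ 0 := by
    induction k with
    | zero => simpa using hc
    | succ k ih =>
      have h1 := (hind.indepFun_eval_sub (zero_le (a := (k + 1) * h))
        (le_add_of_nonneg_right (zero_le (a := h))) hX0).measure_inter_preimage_eq_mul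
          (Iio ((k + 1) * c)) (Iio c) measurableSet_Iio measurableSet_Iio
      rw [(hstat _ h).measure_mem_eq measurableSet_Iio] at h1
      intro h0
      refine mul_ne_zero ih hc (h1.symm.trans (measure_mono_null ?_ h0))
      intro ω hω
      have e : ((k + 1 : ℕ) + 1 : ℝ≥0) * h = (k + 1) * h + h := by push_cast; ring
      simp only [mem_inter_iff, mem_preimage, mem_Iio, Pi.sub_apply] at hω
      simp only [mem_preimage, mem_Iio, e]
      push_cast
      linarith [hω.1, hω.2]
  have hone (n : ℕ) : ∀ᵐ ω ∂P, -C / (n + 1) ≤ X (1 / (n + 1)) ω := by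
    by_contra hcon
    refine hpow (1 / (n + 1)) (-C / (n + 1)) (fun h0 => hcon ?_) n ?_
    · filter_upwards [measure_eq_zero_iff_ae_notMem.1 h0] with ω hω
      simpa using hω
    · have e : ((n : ℝ≥0) + 1) * (1 / (n + 1)) = 1 := mul_one_div_cancel (by positivity)
      have e' : ((n : ℝ) + 1) * (-C / (n + 1)) = -C := mul_div_cancel₀ _ (by positivity)
      rw [e, e', measure_eq_zero_iff_ae_notMem]
      filter_upwards [hC] with ω hω
      simpa using hω
  have hmul (n l : ℕ) : ∀ᵐ ω ∂P, -C * (l / (n + 1) : ℝ≥0) ≤ X (l / (n + 1)) ω := by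
    induction l with
    | zero => 
      filter_upwards [hX0] with ω hω
      simp [hω]
    | succ l ih =>
      filter_upwards [ih, hinc (s := l / (n + 1)) (hone n)] with ω h1 h2
      have e : ((l + 1 : ℕ) : ℝ≥0) / (n + 1) = l / (n + 1) + 1 / (n + 1) := by push_cast; ring
      have e' : -C * ((l : ℝ) / (n + 1) + 1 / (n + 1)) = -C * (l / (n + 1)) + -C / (n + 1) := by
        ring
      rw [e]
      push_cast at h1 ⊢
      linarith
  -- Countably many grid points, hence one common null set.
  have hall : ∀ᵐ ω ∂P, ∀ k l n : ℕ, -C * (l / (n + 1) : ℝ≥0) ≤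
      X (k / (n + 1) + l / (n + 1) : ℝ≥0) ω - X (k / (n + 1) : ℝ≥0) ω := by
    simp only [ae_all_iff]
    exact fun k l n => hinc (hmul n l)
  filter_upwards [hall, hcont] with ω h1 h2
  exact locallyBoundedVariationOn_of_forall_nat_div h2 h1

/-! ### The exponent along one direction -/

lemma quadForm_smul {d : ℕ} (Q : Matrix (Fin d) (Fin d) ℝ) (s : ℝ) (u : EuclideanSpace ℝ (Fin d)) :
    quadForm Q (s • u) = s ^ 2 * quadForm Q u := by
  simp only [quadForm, Finset.mul_sum, PiLp.smul_apply, smul_eq_mul]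
  exact Finset.sum_congr rfl fun i _ => Finset.sum_congr rfl fun j _ => by ring

/-- In a direction without Gaussian part and with jumps of finite first moment, the compensation of
small jumps can be replaced by a drift. -/
lemma levyExponent_smul_eq {d : ℕ} (a : EuclideanSpace ℝ (Fin d)) (Q : Matrix (Fin d) (Fin d) ℝ)
    (ν : Measure (EuclideanSpace ℝ (Fin d))) {g : EuclideanSpace ℝ (Fin d)} (hQ : quadForm Q g = 0)
    (hg : Integrable (fun y => (inner ℝ g y : ℝ)) ν) (s : ℝ) :
    levyExponent a Q ν (s • g) =
      Complex.I * (s * (inner ℝ a g - ∫ y in {y | ‖y‖ ≤ 1}, (inner ℝ g y : ℝ) ∂ν) : ℝ) +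
        ∫ y, (Complex.exp (Complex.I * (s * inner ℝ g y : ℝ)) - 1) ∂ν := by
  have hm : MeasurableSet {y : EuclideanSpace ℝ (Fin d) | ‖y‖ ≤ 1} :=
    measurableSet_le measurable_norm measurable_const
  have h1 : Integrable ({y : EuclideanSpace ℝ (Fin d) | ‖y‖ ≤ 1}.indicator
      fun y => Complex.I * (s * inner ℝ g y : ℝ)) ν :=
    (((hg.const_mul s).ofReal (𝕜 := ℂ)).const_mul Complex.I).indicator hm
  have h2 : ∫ y in {y | ‖y‖ ≤ 1}, Complex.I * (s * inner ℝ g y : ℝ) ∂ν =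
      Complex.I * (s * ∫ y in {y | ‖y‖ ≤ 1}, (inner ℝ g y : ℝ) ∂ν : ℝ) := by
    rw [integral_const_mul, integral_complex_ofReal, integral_const_mul]
  rw [levyExponent, quadForm_smul, hQ]
  have h3 : ∀ y : EuclideanSpace ℝ (Fin d),
      (Complex.exp (Complex.I * (inner ℝ (s • g) y : ℝ)) - 1 -
        if ‖y‖ ≤ 1 then Complex.I * (inner ℝ (s • g) y : ℝ) else 0) =
      (Complex.exp (Complex.I * (s * inner ℝ g y : ℝ)) - 1) -
        {y : EuclideanSpace ℝ (Fin d) | ‖y‖ ≤ 1}.indicator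
          (fun y => Complex.I * (s * inner ℝ g y : ℝ)) y := by
    intro y
    simp only [real_inner_smul_left, indicator, mem_ofPred_eq]
  have h4 : ∫ y, (Complex.exp (Complex.I * (inner ℝ (s • g) y : ℝ)) - 1 -
        if ‖y‖ ≤ 1 then Complex.I * (inner ℝ (s • g) y : ℝ) else 0) ∂ν =
      (∫ y, (Complex.exp (Complex.I * (s * inner ℝ g y : ℝ)) - 1) ∂ν) -
        Complex.I * (s * ∫ y in {y | ‖y‖ ≤ 1}, (inner ℝ g y : ℝ) ∂ν : ℝ) := by
    rw [← h2, ← integral_indicator hm, ← integral_sub (integrable_cexp_sub_one hg s) h1]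
    exact integral_congr_ae (ae_of_all _ h3)
  rw [real_inner_smul_right]
  refine (congrArg _ h4).trans ?_
  push_cast
  ring

lemma integrable_inner_of_projMeasure {d : ℕ} {ν : Measure (EuclideanSpace ℝ (Fin d))}
    {g : EuclideanSpace ℝ (Fin d)} (h0 : projMeasure ν g (Iio 0) = 0)
    (h : ∫⁻ v in Ioi 0, ENNReal.ofReal v ∂(projMeasure ν g) < ∞) :
    0 ≤ᵐ[ν] (fun y => (inner ℝ g y : ℝ)) ∧ Integrable (fun y => (inner ℝ g y : ℝ)) ν := by
  have hm : Measurable fun y => (inner ℝ g y : ℝ) := by fun_prop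
  have hpos : 0 ≤ᵐ[ν] (fun y => (inner ℝ g y : ℝ)) := by
    rw [projMeasure, Measure.map_apply hm measurableSet_Iio, measure_eq_zero_iff_ae_notMem] at h0
    filter_upwards [h0] with y hy
    simpa using hy
  refine ⟨hpos, hm.aestronglyMeasurable, (hasFiniteIntegral_iff_ofReal hpos).2 ?_⟩
  rw [projMeasure, setLIntegral_map measurableSet_Ioi (by fun_prop) hm] at h
  rw [← lintegral_indicator (hm measurableSet_Ioi)] at h
  refine lt_of_le_of_lt (lintegral_mono fun y => ?_) h
  rcases le_or_gt (inner ℝ g y : ℝ) 0 with hy | hy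
  · simp [ENNReal.ofReal_of_nonpos hy]
  · rw [indicator_of_mem (by exact hy)]

/-- If the projection of `Z` in direction `g` has no Gaussian part and positive jumps of finite first
moment only, then it is bounded below at time `1`. -/
lemma exists_ae_le_inner {Ω : Type*} [MeasurableSpace Ω] {P : Measure Ω} [IsProbabilityMeasure P]
    {d : ℕ} {Z : ℝ≥0 → Ω → EuclideanSpace ℝ (Fin d)} {a : EuclideanSpace ℝ (Fin d)}
    {Q : Matrix (Fin d) (Fin d) ℝ} {ν : Measure (EuclideanSpace ℝ (Fin d))}
    (hZ : AEMeasurable (Z 1) P) (hT : HasTriplet Z P a Q ν) {g : EuclideanSpace ℝ (Fin d)}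
    (hQ : quadForm Q g = 0) (h0 : projMeasure ν g (Iio 0) = 0)
    (h : ∫⁻ v in Ioi 0, ENNReal.ofReal v ∂(projMeasure ν g) < ∞) :
    ∃ b : ℝ, ∀ᵐ ω ∂P, b ≤ inner ℝ g (Z 1 ω) := by
  obtain ⟨hpos, hint⟩ := integrable_inner_of_projMeasure h0 h
  set b : ℝ := inner ℝ a g - ∫ y in {y | ‖y‖ ≤ 1}, (inner ℝ g y : ℝ) ∂ν with hb
  have hSm : AEMeasurable (fun ω => inner ℝ g (Z 1 ω) - b) P := by fun_prop
  have hprob : IsProbabilityMeasure (P.map fun ω => inner ℝ g (Z 1 ω) - b) :=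
    Measure.isProbabilityMeasure_map hSm
  -- Subtracting `b` cancels the drift and leaves the pure jump exponent.
  have hch (s : ℝ) : charFun (P.map fun ω => inner ℝ g (Z 1 ω) - b) s =
      Complex.exp (∫ y, (Complex.exp (Complex.I * (s * inner ℝ g y : ℝ)) - 1) ∂ν) := by
    have h1 := hT.charFun_eq 1 (s • g)
    rw [levyExponent_smul_eq a Q ν hQ hint, ← hb, charFun_apply,
      integral_map hZ (by fun_prop)] at h1
    rw [charFun_apply_real, integral_map hSm (by fun_prop)]
    have h2 (ω : Ω) : Complex.exp (s * (inner ℝ g (Z 1 ω) - b : ℝ) * Complex.I) =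
        Complex.exp (-(Complex.I * (s * b : ℝ))) *
          Complex.exp ((inner ℝ (Z 1 ω) (s • g) : ℝ) * Complex.I) := by
      rw [← Complex.exp_add, real_inner_smul_right, real_inner_comm]
      congr 1
      push_cast
      ring
    simp_rw [h2]
    rw [integral_const_mul, h1, ← Complex.exp_add]
    congr 1
    push_cast
    ring
  have h3 := measure_Iio_eq_zero_of_charFun_eq (by fun_prop) hint hpos hch
  rw [measure_eq_zero_iff_ae_notMem] at h3
  refine ⟨b, ?_⟩
  filter_upwards [ae_of_ae_map hSm h3] with ω hω
  simpa using hω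

/-- A coordinate in which `g` does not vanish has finite variation as soon as the coordinates are
independent and `⟨g, Z⟩` is bounded below at time `1`. -/
lemma isFiniteVariation_coordinate {Ω : Type*} [MeasurableSpace Ω] {P : Measure Ω}
    [IsProbabilityMeasure P] {d : ℕ} {Z : ℝ≥0 → Ω → EuclideanSpace ℝ (Fin d)}
    (hZ : IsLevyProcess Z P) (hindep : HasIndepCoordinates Z P)
    {g : EuclideanSpace ℝ (Fin d)} {b : ℝ} (hb : ∀ᵐ ω ∂P, b ≤ inner ℝ g (Z 1 ω))
    {i : Fin d} (hi : g i ≠ 0) : IsFiniteVariation (fun t ω => Z t ω i) P := by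
  have hsum : ∀ᵐ ω ∂P, b ≤ g i * Z 1 ω i + ∑ j ∈ Finset.univ.erase i, g j * Z 1 ω j := by
    filter_upwards [hb] with ω hω
    rw [Finset.add_sum_erase _ (fun j => g j * Z 1 ω j) (Finset.mem_univ i)]
    simpa [PiLp.inner_apply, mul_comm] using hω
  have hind : iIndepFun (fun (j : Fin d) ω => g j * Z 1 ω j) P :=
    hindep.comp (fun j (x : ℝ≥0 → ℝ) => g j * x 1) fun j => by fun_prop
  have hAB : IndepFun (fun ω => g i * Z 1 ω i)
      (fun ω => ∑ j ∈ Finset.univ.erase i, g j * Z 1 ω j) P := by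
    have hm (j : Fin d) : AEMeasurable (fun ω => g j * Z 1 ω j) P := by
      have := hZ.measurable 1
      fun_prop
    have := (hind.indepFun_finsetSum_of_notMem₀ hm (Finset.notMem_erase i Finset.univ)).symm
    convert this using 2
    simp
  obtain ⟨C, hC⟩ := exists_ae_le_of_indepFun hAB hsum
  -- The sign of `g i` is unknown, so the lower bound holds for the scaled coordinate; the scaling
  -- is undone once finite variation is known.
  let L : EuclideanSpace ℝ (Fin d) →L[ℝ] ℝ := g i • EuclideanSpace.proj i
  have hL (x : EuclideanSpace ℝ (Fin d)) : L x = g i * x i := by simp [L]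
  have hfv : IsFiniteVariation (fun t ω => L (Z t ω)) P := by
    refine isFiniteVariation_of_ae_le (C := C) ?_ (hZ.indep_increments.map L) (fun s h => ?_) ?_ ?_
    · filter_upwards [hZ.start_zero] with ω hω
      simp [hω]
    · have e : (fun ω => L (Z (s + h) ω)) - (fun ω => L (Z s ω)) = L ∘ (Z (s + h) - Z s) := by
        ext ω
        simp
      rw [e]
      exact (hZ.stationary_increments s h).comp L.measurable
    · filter_upwards [hZ.cadlag] with ω hω t
      exact L.continuous.continuousAt.comp_continuousWithinAt (hω t).1
    · simpa only [hL] using hC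
  filter_upwards [hfv] with ω hω
  have e : (fun t => Z t ω i) = (fun x : ℝ => (g i)⁻¹ • x) ∘ fun t => L (Z t ω) := by
    ext t
    simp [hL, hi]
  rw [e]
  exact (lipschitzWith_smul (g i)⁻¹).comp_locallyBoundedVariationOn hω

end LevyAffine

theorem mainTheorem8 {Ω : Type*} [MeasurableSpace Ω] (P : Measure Ω) [IsProbabilityMeasure P]
    (d : ℕ) (G : ℝ≥0 → EuclideanSpace ℝ (Fin d)) (Z : ℝ≥0 → Ω → EuclideanSpace ℝ (Fin d))
    (hGZ : LevyAffine.IsGeneratingPair G Z P)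
    (hindep : LevyAffine.HasIndepCoordinates Z P)
    (hvar : ∀ i : Fin d, LevyAffine.IsInfiniteVariation (fun t ω => Z t ω i) P) :
    G 0 = 0 := by
  obtain ⟨hM, a, Q, ν, hT, hG⟩ := hGZ
  obtain ⟨c, μ, -, -, -, haff⟩ := hG.affine
  have hQ : LevyAffine.quadForm Q (G 0) = 0 := by simpa using (haff 0).1
  obtain ⟨b, hb⟩ := LevyAffine.exists_ae_le_inner (hM.levy.measurable 1) hT hQ
    (hG.positive_jumps 0) hG.finite_variation_zero
  ext i
  by_contra hi
  exact hvar i (LevyAffine.isFiniteVariation_coordinate hM.levy hindep hb hi)
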